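/- An $n$-mapping is a function $f:\{1,\dots,n\}\to\{1,\dots,n\}$. Its components are the connected components of its functional graph (vertices $1,\dots,n$, edges $x\to f(x)$, directions ignored), and a point $x$ is cyclic if $f^k(x)=x$ for some $k\ge 1$. Fix an integer $m\ge 2$. For $n\ge m$, let $N=N_n$ be the number of cyclic points of an $n$-mapping chosen uniformly at random, conditioned on having exactly $m$ components. Then, as $n\to\infty$ with $m$ fixed, $$\mathbb{E}(N)\sim\sqrt{\frac{2n}{\pi}},\qquad \mathbb{E}(N^2)\sim n,\qquad \mathbb{V}(N)\sim\left(1-\frac{2}{\pi}\right)n.$$ -/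

import Mathlib

open Filter Asymptotics MeasureTheory ProbabilityTheory

namespace RandomMapping

/-- The functional graph of `f`, as an undirected simple graph: `x ≠ y` are adjacent iff
`f x = y` or `f y = x`. (Loops at fixed points are dropped; they do not affect components.) -/
def functionalGraph {n : ℕ} (f : Fin n → Fin n) : SimpleGraph (Fin n) :=
  SimpleGraph.fromRel (fun x y => f x = y)

/-- The number `M` of connected components of the mapping `f`. -/
noncomputable def numComponents {n : ℕ} (f : Fin n → Fin n) : ℕ :=
  Nat.card (functionalGraph f).ConnectedComponent

/-- The number `N` of cyclic points of the mapping `f`, i.e. of points `x` with `f^[k] x = x`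
for some `k > 0`. -/
noncomputable def numCyclic {n : ℕ} (f : Fin n → Fin n) : ℕ :=
  (Function.periodicPts f).ncard

/-- The law of a uniformly random mapping of an `n`-element set into itself, conditioned on
having exactly `m` components. -/
noncomputable def mappingLaw (n m : ℕ) : Measure (Fin n → Fin n) :=
  cond (uniformOn Set.univ) {f | numComponents f = m}

end RandomMapping

/-! A mapping is determined by its cyclic points `S`, a permutation `σ` of `S`, and forests hanging
from `S`. Its components correspond to the cycles of `σ`, and exactly `s * n ^ (n - s - 1)` mappings
share a given pair `(S, σ)` with `s = |S| ≥ 1` (`card_core_eq`). Permutations with `m` cycles are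
counted by Stirling numbers (`card_perm_orbitSpace`), so the number of mappings with `m` components
and `k` cyclic points is explicit (`sum_numComponents_eq`).

With `m = r + 2` and `k + 1` cyclic points, that number is `n ^ (n - 1)` times `fallWeight n k *
normStirling (r + 1) k`. For `k ≈ x√n` the first factor tends to `exp (-x² / 2)`. The second is of
order `(log k) ^ (r + 1)`; only its slow variation matters, since it then becomes a constant factor
at scale `√n` and cancels between numerator and denominator of a moment
(`tendsto_normStirling_ratio`). Dominated convergence (`tendsto_sum_scaledTerm`) shows that the
moments of `N / √n` converge to those of the half-normal law: `√(2/π)` for the first and `1` for the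
second, whence the variance. -/

namespace RandomMapping

open Topology

/-! ### Components as orbits; cycles and Stirling numbers -/

/-- The set of weak components of the functional graph of `f`, as a quotient by `x ∼ f x`. -/
def OrbitSpace {α : Type*} (f : α → α) : Type _ := Quot fun x y => f x = y

namespace OrbitSpace

variable {α β : Type*}

/-- The component of a point. -/
def mk (f : α → α) (x : α) : OrbitSpace f := Quot.mk _ x

lemma mk_apply (f : α → α) (x : α) : mk f (f x) = mk f x := by
  exact (Quot.sound (r := fun x y => f x = y) rfl).symm

lemma mk_iterate (f : α → α) (k : ℕ) (x : α) : mk f (f^[k] x) = mk f x := by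
  induction k with
  | zero => rfl
  | succ k ih => rw [Function.iterate_succ_apply', mk_apply, ih]

/-- Maps out of the orbit space are the maps that are constant along `f`. -/
def lift {γ : Type*} {f : α → α} (φ : α → γ) (h : ∀ x, φ (f x) = φ x) : OrbitSpace f → γ :=
  Quot.lift φ fun x y hxy => by rw [← hxy, h]

@[simp] lemma lift_mk {γ : Type*} {f : α → α} (φ : α → γ) (h : ∀ x, φ (f x) = φ x) (x : α) :
    lift φ h (mk f x) = φ x := rfl

lemma ind {f : α → α} {p : OrbitSpace f → Prop} (h : ∀ x, p (mk f x)) (q : OrbitSpace f) : p q :=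
  Quot.ind h q

instance {f : α → α} [Finite α] : Finite (OrbitSpace f) := inferInstanceAs (Finite (Quot _))

/-- Conjugate maps have equivalent orbit spaces. -/
def congr {f : α → α} {g : β → β} (e : α ≃ β) (h : ∀ x, e (f x) = g (e x)) :
    OrbitSpace f ≃ OrbitSpace g where
  toFun := lift (fun x => mk g (e x)) fun x => by rw [h, mk_apply]
  invFun := lift (fun y => mk f (e.symm y)) fun y => by
    obtain ⟨x, rfl⟩ := e.surjective y
    rw [← h, e.symm_apply_apply, e.symm_apply_apply, mk_apply]
  left_inv := ind fun x => by simp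
  right_inv := ind fun x => by simp

/-- If every orbit of `f` runs into an invariant subset within `N` steps, then restricting to this
subset does not change the orbit space. -/
def restrict {ι : Type*} {f : α → α} {g : ι → ι} (e : ι → α) (he : Function.Injective e)
    (h : ∀ i, f (e i) = e (g i)) (N : ℕ) (r : α → ι) (hr : ∀ x, e (r x) = f^[N] x) :
    OrbitSpace g ≃ OrbitSpace f where
  toFun := lift (fun i => mk f (e i)) fun i => by rw [← h, mk_apply]
  invFun := lift (fun x => mk g (r x)) fun x => by
    -- Commuting `f` past its `N`-th iterate gives this equality after applying `e`, which is
    -- injective.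
    have : r (f x) = g (r x) := he (by
      rw [hr, ← h, hr, ← Function.iterate_succ_apply, Function.iterate_succ_apply'])
    rw [this, mk_apply]
  left_inv := ind fun i => by
    have key : ∀ k, f^[k] (e i) = e (g^[k] i) := fun k => by
      induction k with
      | zero => rfl
      | succ k ih => rw [Function.iterate_succ_apply', Function.iterate_succ_apply', ih, h]
    have : r (e i) = g^[N] i := he (by rw [hr, key])
    simp only [lift_mk]
    rw [this, mk_iterate]
  right_inv := ind fun x => by
    simp only [lift_mk]
    rw [hr, mk_iterate]

open Equiv in
/-- Adjoining a fixed point to a permutation adjoins a point to the orbit space. -/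
def optionNone [DecidableEq α] (σ : Perm α) :
    OrbitSpace (Perm.decomposeOption.symm (none, σ)) ≃ Option (OrbitSpace σ) where
  toFun := lift (fun x => x.map (mk σ)) fun x => by
    cases x with
    | none => simp
    | some x => simp [mk_apply]
  invFun o := o.elim (mk _ none) (lift (fun x => mk _ (some x)) fun x => by
    have : some (σ x) = Perm.decomposeOption.symm (none, σ) (some x) := by simp
    rw [this, mk_apply])
  left_inv := ind fun x => by cases x <;> simp
  right_inv o := by
    cases o with
    | none => simp
    | some q =>
      induction q using ind with
      | h x => simp

open Equiv in
/-- Inserting a point into a cycle of a permutation does not change the orbit space. -/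
def optionSome [DecidableEq α] (a : α) (σ : Perm α) :
    OrbitSpace (Perm.decomposeOption.symm (some a, σ)) ≃ OrbitSpace σ where
  toFun := lift (fun x => x.elim (mk σ a) (mk σ)) fun x => by
    cases x with
    | none => simp
    | some x =>
      -- Only the preimage of `a` changes its image: it now goes to `none`, which goes to `a`.
      by_cases hx : σ x = a
      · simp [hx, ← mk_apply σ x]
      · have : swap none (some a) (some (σ x)) = some (σ x) :=
          swap_apply_of_ne_of_ne (by simp) (by simpa using hx)
        simp [this, mk_apply]
  invFun := lift (fun x => mk _ (some x)) fun x => by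
    set τ := Perm.decomposeOption.symm (some a, σ) with hτ
    by_cases hx : σ x = a
    · have h1 : τ (some x) = none := by simp [hτ, hx]
      have h2 : τ none = some a := by simp [hτ]
      rw [hx, ← h2, mk_apply, ← h1, mk_apply]
    · have : τ (some x) = some (σ x) := by
        have : swap none (some a) (some (σ x)) = some (σ x) :=
          swap_apply_of_ne_of_ne (by simp) (by simpa using hx)
        simp [hτ, this]
      rw [← this, mk_apply]
  left_inv := ind fun x => by
    cases x with
    | none =>
      have h2 : Perm.decomposeOption.symm (some a, σ) none = some a := by simp
      simp only [lift_mk, Option.elim]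
      exact (congrArg _ h2.symm).trans (mk_apply _ none)
    | some x => simp
  right_inv := ind fun x => by simp

end OrbitSpace

universe u in
/-- The number of permutations with `m` cycles is a Stirling number of the first kind. -/
theorem card_perm_orbitSpace (α : Type u) [Finite α] (m : ℕ) :
    Nat.card {σ : Equiv.Perm α // Nat.card (OrbitSpace σ) = m} =
      Nat.stirlingFirst (Nat.card α) m := by
  revert m
  induction α using Finite.induction_empty_option with
  | of_equiv e ih =>
    intro m
    rw [← Nat.card_congr e, ← ih]
    refine (Nat.card_congr (e.permCongr.subtypeEquiv fun σ => ?_)).symm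
    rw [Nat.card_congr (OrbitSpace.congr (f := σ) (g := e.permCongr σ) e (by simp))]
  | h_empty =>
    intro m
    have h0 : ∀ σ : Equiv.Perm PEmpty.{u + 1}, Nat.card (OrbitSpace σ) = 0 := fun σ => by
      have : IsEmpty (OrbitSpace σ) := ⟨OrbitSpace.ind (fun x => x.elim)⟩
      simp
    cases m with
    | zero => simp [h0]
    | succ m => simp [h0]
  | h_option ih =>
    rename_i α _
    intro m
    classical
    have := Fintype.ofFinite α
    -- The new point is either fixed, adding one cycle, or inserted into a cycle at one of `|α|`
    -- places, adding none. This is the Stirling recurrence.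
    rw [Nat.card_congr (Equiv.Perm.decomposeOption.subtypeEquiv
      (q := fun p => Nat.card (OrbitSpace (Equiv.Perm.decomposeOption.symm p)) = m)
        fun σ => by rw [Equiv.symm_apply_apply])]
    have h1 : ∀ σ : Equiv.Perm α, Nat.card (OrbitSpace (Equiv.Perm.decomposeOption.symm (none, σ)))
        = Nat.card (OrbitSpace σ) + 1 := fun σ => by
      rw [Nat.card_congr (OrbitSpace.optionNone σ), Finite.card_option]
    have h2 : ∀ a (σ : Equiv.Perm α),
        Nat.card (OrbitSpace (Equiv.Perm.decomposeOption.symm (some a, σ)))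
        = Nat.card (OrbitSpace σ) := fun a σ => Nat.card_congr (OrbitSpace.optionSome a σ)
    simp only [Nat.card_eq_fintype_card (α := {p : Option α × Equiv.Perm α // _}),
      Fintype.card_subtype, Finset.card_filter, Fintype.sum_prod_type, Fintype.sum_option, h1, h2,
      Finset.sum_const, Finset.card_univ]
    simp only [← Finset.card_filter, ← Fintype.card_subtype, ← Nat.card_eq_fintype_card, smul_eq_mul,
      Finite.card_option, ih]
    cases m with
    | zero =>
      simp only [Nat.add_eq_zero_iff, one_ne_zero, and_false, Nat.card_eq_fintype_card,
        Fintype.card_subtype, Finset.filter_false, Finset.card_empty, zero_add]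
      cases h : Fintype.card α <;> simp
    | succ m =>
      simp only [Nat.add_right_cancel_iff, ih]
      rw [Nat.stirlingFirst_succ_succ, add_comm]

lemma numComponents_eq {n : ℕ} (f : Fin n → Fin n) :
    numComponents f = Nat.card (OrbitSpace f) := by
  refine Nat.card_congr
    { toFun := SimpleGraph.ConnectedComponent.lift (OrbitSpace.mk f) ?_
      invFun := OrbitSpace.lift (functionalGraph f).connectedComponentMk ?_
      left_inv := ?_
      right_inv := OrbitSpace.ind fun x => rfl }
  · intro v w p hp
    clear hp
    induction p with
    | nil => rfl
    | cons h p ih =>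
      rw [← ih]
      rw [functionalGraph, SimpleGraph.fromRel_adj] at h
      obtain ⟨_, rfl | rfl⟩ := h <;> rw [OrbitSpace.mk_apply]
  · intro x
    by_cases h : f x = x
    · rw [h]
    · refine SimpleGraph.ConnectedComponent.sound (SimpleGraph.Adj.reachable ?_)
      rw [functionalGraph, SimpleGraph.fromRel_adj]
      exact ⟨h, Or.inr rfl⟩
  · intro c
    induction c using SimpleGraph.ConnectedComponent.ind
    rfl

/-! ### Counting mappings by their cyclic core -/

/-- Pigeonhole: two of the first `|α| + 1` iterates coincide, so one of them is periodic, and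
periodicity persists under `f`. -/
lemma iterate_card_mem_periodicPts {α : Type*} [Fintype α] (f : α → α) (x : α) :
    f^[Fintype.card α] x ∈ Function.periodicPts f := by
  obtain ⟨i, j, hij, h⟩ := Fintype.exists_ne_map_eq_of_card_lt
    (fun i : Fin (Fintype.card α + 1) => f^[i] x) (by simp)
  wlog hlt : i < j generalizing i j
  · exact this j i hij.symm h.symm (lt_of_le_of_ne (not_lt.1 hlt) hij.symm)
  have hi : f^[i] x ∈ Function.periodicPts f := by
    refine Function.mk_mem_periodicPts (n := j - i) (Nat.sub_pos_of_lt hlt) ?_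
    rw [Function.IsPeriodicPt, Function.IsFixedPt, ← Function.iterate_add_apply,
      Nat.sub_add_cancel hlt.le]
    exact h.symm
  have hmaps := ((Function.bijOn_periodicPts f).mapsTo.iterate
    (Fintype.card α - i)) hi
  rwa [← Function.iterate_add_apply, Nat.sub_add_cancel (Nat.le_of_lt_succ i.2)] at hmaps

open Equiv in
/-- Permutations extending a given permutation of a subset. -/
lemma card_perm_extending {ι β : Type*} [Fintype ι] [Fintype β] [DecidableEq β]
    (e : ι → β) (he : Function.Injective e) (σ : Perm ι) :
    Fintype.card {τ : Perm β // ∀ i, τ (e i) = e (σ i)} =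
      (Fintype.card β - Fintype.card ι).factorial := by
  classical
  set r := Equiv.ofInjective e he with hr
  have hrv : ∀ i, (r i : β) = e i := fun i => rfl
  let e₀ : Set.range e ≃ Set.range e := r.symm.trans (σ.trans r)
  have h1 : Fintype.card {τ : Perm β // ∀ i, τ (e i) = e (σ i)} =
      Fintype.card {τ : Perm β // ∀ x : Set.range e, τ x = e₀ x} := by
    refine Fintype.card_congr (Equiv.subtypeEquivRight fun τ => ?_)
    rw [r.symm.forall_congr_left]
    simp [e₀, hrv]
  rw [h1, Fintype.card_congr (Equiv.Set.compl e₀), Fintype.card_perm, Fintype.card_compl_set,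
    Set.card_range_of_injective he]

/-- Maps extending a given map on a subset. -/
lemma card_fun_extending {α : Type*} [Fintype α] [DecidableEq α] (S : Finset α) (g : S → α) :
    Fintype.card {f : α → α // ∀ x : S, f x = g x} =
      Fintype.card α ^ (Fintype.card α - S.card) := by
  have h := Fintype.card_congr (Equiv.subtypePreimage (· ∈ S) g)
  rw [Fintype.card_fun, Fintype.card_subtype_compl, Fintype.card_coe] at h
  rw [← h]
  exact Fintype.card_congr (Equiv.subtypeEquivRight fun f => by
    simp [funext_iff])

section Core

variable {α : Type*} [Fintype α]

open Classical in
/-- The finite set of cyclic points. -/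
noncomputable def cyclicPts (f : α → α) : Finset α := {x | x ∈ Function.periodicPts f}

lemma mem_cyclicPts {f : α → α} {x : α} : x ∈ cyclicPts f ↔ x ∈ Function.periodicPts f := by
  simp [cyclicPts]

lemma apply_mem_cyclicPts {f : α → α} {x : α} (hx : x ∈ cyclicPts f) : f x ∈ cyclicPts f :=
  mem_cyclicPts.2 ((Function.bijOn_periodicPts f).mapsTo (mem_cyclicPts.1 hx))

/-- The permutation induced by a map on its cyclic points. -/
noncomputable def cyclicPerm (f : α → α) : Equiv.Perm (cyclicPts f) :=
  Equiv.ofBijective (fun x => ⟨f x, apply_mem_cyclicPts x.2⟩)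
    (Finite.injective_iff_bijective.1 fun x y h => Subtype.ext
      ((Function.bijOn_periodicPts f).injOn (mem_cyclicPts.1 x.2) (mem_cyclicPts.1 y.2)
        (congrArg Subtype.val h)))

/-- The cyclic points of a map together with the permutation induced on them. -/
noncomputable def core (f : α → α) : Σ S : Finset α, Equiv.Perm S := ⟨cyclicPts f, cyclicPerm f⟩

lemma core_eq_iff {f : α → α} {S : Finset α} {σ : Equiv.Perm S} :
    core f = ⟨S, σ⟩ ↔ cyclicPts f = S ∧ ∀ x : S, f x = σ x := by
  constructor
  · intro h
    cases h
    exact ⟨rfl, fun x => rfl⟩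
  · rintro ⟨rfl, h⟩
    rw [core]
    congr 1
    ext x
    exact h x

/-- The map and its cyclic permutation have the same number of components. -/
lemma card_orbitSpace_of_core_eq {f : α → α} {S : Finset α} {σ : Equiv.Perm S}
    (h : core f = ⟨S, σ⟩) : Nat.card (OrbitSpace f) = Nat.card (OrbitSpace σ) := by
  obtain ⟨hS, hσ⟩ := core_eq_iff.1 h
  refine (Nat.card_congr (OrbitSpace.restrict (Subtype.val : S → α) Subtype.val_injective hσ
    (Fintype.card α) (fun x => ⟨f^[Fintype.card α] x, ?_⟩) fun x => rfl)).symm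
  rw [← hS, mem_cyclicPts]
  exact iterate_card_mem_periodicPts f x

/-- A permutation of a finite set has finite order, so every point of `S` returns to itself.
Extending `σ` can only create further cyclic points, never destroy those of `S`. -/
lemma subset_cyclicPts_of_extends {f : α → α} {S : Finset α} {σ : Equiv.Perm S}
    (h : ∀ x : S, f x = σ x) : S ⊆ cyclicPts f := by
  intro x hx
  have key : ∀ k, f^[k] x = (σ^[k] ⟨x, hx⟩ : S) := fun k => by
    induction k with
    | zero => rfl
    | succ k ih => rw [Function.iterate_succ_apply', Function.iterate_succ_apply', ih, h]
  obtain ⟨k, hk, hk'⟩ := isOfFinOrder_iff_pow_eq_one.1 (isOfFinOrder_of_finite σ)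
  refine mem_cyclicPts.2 (Function.mk_mem_periodicPts hk ?_)
  rw [Function.IsPeriodicPt, Function.IsFixedPt, key, ← Equiv.Perm.coe_pow, hk']
  rfl

/-- With `a j = N.descFactorial j * n ^ (N - j + 1)`, the summand is `a j - a (j + 1)`, because `n -
(N - j) = s + j`. -/
lemma telescoping_descFactorial (n s : ℕ) (N : ℕ) (hN : N + s = n) (J : ℕ) (hJ : J ≤ N) :
    ∑ j ∈ Finset.range J, N.descFactorial j * ((s + j) * n ^ (N - j)) +
      N.descFactorial J * n ^ (N - J + 1) = n ^ (N + 1) := by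
  induction J with
  | zero => simp
  | succ J ih =>
    rw [← ih (by omega), Finset.sum_range_succ, add_assoc]
    congr 1
    obtain ⟨d, hd⟩ : ∃ d, N = J + 1 + d := ⟨N - (J + 1), by omega⟩
    have e1 : N - J = d + 1 := by omega
    have e2 : N - (J + 1) = d := by omega
    rw [Nat.descFactorial_succ, e1, e2]
    have : s + J + (d + 1) = n := by omega
    calc _ = N.descFactorial J * n ^ (d + 1) * (s + J + (d + 1)) := by ring
      _ = _ := by rw [this]; ring

lemma sum_superset_core (n s N : ℕ) (hN : N + s = n) :
    ∑ j ∈ Finset.range (N + 1), N.choose j * (j.factorial * ((s + j) * n ^ (N - j))) =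
      n ^ (N + 1) := by
  rw [← telescoping_descFactorial n s N hN N le_rfl, Finset.sum_range_succ]
  congr 1
  · refine Finset.sum_congr rfl fun j _ => ?_
    rw [Nat.descFactorial_eq_factorial_mul_choose]; ring
  · rw [Nat.descFactorial_eq_factorial_mul_choose]
    simp only [Nat.sub_self, hN, add_comm s N]
    ring

variable [DecidableEq α]

/-- Maps with given cyclic points and given action on them: `n ^ (n - s)` maps extend the action,
and a fraction `s / n` of them have no further cyclic points. -/
theorem card_core_eq (S : Finset α) (σ : Equiv.Perm S) :
    Fintype.card α * Fintype.card {f : α → α // core f = ⟨S, σ⟩} =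
      S.card * Fintype.card α ^ (Fintype.card α - S.card) := by
  classical
  -- Downward induction on `S`: all maps extending `σ` are sorted by their core `(T, τ)`, and the
  -- count is already known for `T` strictly larger than `S`.
  induction hd : Fintype.card α - S.card using Nat.strong_induction_on generalizing S with
  | _ d ih =>
  subst hd
  have hle : S.card ≤ Fintype.card α := S.card_le_univ
  have hfib : ∀ (T : Finset α) (τ : Equiv.Perm T),
      Fintype.card {f : α → α // core f = ⟨T, τ⟩ ∧ ∀ x : S, f x = σ x} =
        if ∃ h : S ⊆ T, ∀ x : S, τ ⟨x, h x.2⟩ = ⟨σ x, h (σ x).2⟩ then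
          Fintype.card {f : α → α // core f = ⟨T, τ⟩} else 0 := by
    intro T τ
    split_ifs with h
    · obtain ⟨h, h'⟩ := h
      refine Fintype.card_congr (Equiv.subtypeEquivRight fun f => ?_)
      refine and_iff_left_of_imp fun hf x => ?_
      rw [(core_eq_iff.1 hf).2 ⟨x, h x.2⟩, h']
    · rw [Fintype.card_eq_zero_iff]
      refine ⟨fun ⟨f, hf, hx⟩ => h ?_⟩
      obtain ⟨rfl, hf⟩ := core_eq_iff.1 hf
      exact ⟨subset_cyclicPts_of_extends hx, fun x => Subtype.ext (by rw [← hf, hx])⟩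
  have htot : Fintype.card α ^ (Fintype.card α - S.card) =
      ∑ T : Finset α, ∑ τ : Equiv.Perm T,
        Fintype.card {f : α → α // core f = ⟨T, τ⟩ ∧ ∀ x : S, f x = σ x} := by
    rw [← card_fun_extending S (fun x => σ x), Fintype.card_subtype,
      Finset.card_eq_sum_card_fiberwise (f := core) (t := Finset.univ)
        (fun _ _ => Finset.mem_coe.2 (Finset.mem_univ _)), Fintype.sum_sigma]
    refine Finset.sum_congr rfl fun T _ => Finset.sum_congr rfl fun τ _ => ?_
    rw [Finset.filter_filter, Fintype.card_subtype]
    congr 1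
    ext f
    simp [and_comm]
  have hT : ∀ T : Finset α, S ⊂ T → Fintype.card α * ∑ τ : Equiv.Perm T,
        Fintype.card {f : α → α // core f = ⟨T, τ⟩ ∧ ∀ x : S, f x = σ x} =
      (T.card - S.card).factorial * (T.card * Fintype.card α ^ (Fintype.card α - T.card)) := by
    intro T hST
    have hcard := Finset.card_lt_card hST
    have hTle := T.card_le_univ
    have := card_perm_extending (fun x : S => (⟨x, hST.1 x.2⟩ : T))
      (fun x y h => Subtype.ext (congrArg (fun z : T => (z : α)) h)) σ
    rw [Fintype.card_coe, Fintype.card_coe, Fintype.card_subtype] at this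
    rw [← this, Finset.card_filter, Finset.sum_mul, Finset.mul_sum]
    refine Finset.sum_congr rfl fun τ _ => ?_
    rw [hfib, mul_ite, ih _ (by omega) T τ rfl]
    simp [hST.1]
  have hS : ∑ τ : Equiv.Perm S,
        Fintype.card {f : α → α // core f = ⟨S, τ⟩ ∧ ∀ x : S, f x = σ x} =
      Fintype.card {f : α → α // core f = ⟨S, σ⟩} := by
    rw [Finset.sum_eq_single σ]
    · rw [hfib, if_pos ⟨subset_rfl, fun x => rfl⟩]
    · intro τ _ hτ
      rw [hfib, if_neg]
      rintro ⟨_, h⟩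
      exact hτ (Equiv.ext h)
    · simp
  have hnot : ∀ T : Finset α, ¬ S ⊆ T → ∑ τ : Equiv.Perm T,
        Fintype.card {f : α → α // core f = ⟨T, τ⟩ ∧ ∀ x : S, f x = σ x} = 0 := by
    intro T hST
    refine Finset.sum_eq_zero fun τ _ => ?_
    rw [hfib, if_neg]
    rintro ⟨h, _⟩
    exact hST h
  -- The claimed counts, including the one at `T = S`, add up to the right total. Subtracting the
  -- known terms `T ≠ S` from this and from `htot'` isolates the term at `S`.
  have hid : ∑ T ∈ Finset.Icc S Finset.univ,
      (T.card - S.card).factorial * (T.card * Fintype.card α ^ (Fintype.card α - T.card)) =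
      Fintype.card α ^ (Fintype.card α - S.card + 1) := by
    rw [← sum_superset_core _ S.card (Fintype.card α - S.card) (by omega),
      Finset.Icc_eq_image_powerset (Finset.subset_univ S), Finset.sum_image]
    · rw [← Finset.card_univ, ← Finset.card_sdiff_of_subset (Finset.subset_univ S)]
      simp only [← smul_eq_mul (a := Nat.choose _ _)]
      rw [← Finset.sum_powerset_apply_card (fun j => j.factorial * ((S.card + j) *
        (Finset.univ : Finset α).card ^ ((Finset.univ \ S).card - j)))]
      refine Finset.sum_congr rfl fun J hJ => ?_
      have hdis : Disjoint S J := by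
        rw [Finset.mem_powerset] at hJ
        exact Finset.disjoint_sdiff.mono_right hJ
      rw [Finset.card_union_of_disjoint hdis, Nat.add_sub_cancel_left,
        Finset.card_sdiff_of_subset (Finset.subset_univ S), Nat.sub_add_eq]
    · intro J hJ K hK h
      simp only [Finset.coe_powerset, Set.mem_preimage, Set.mem_powerset_iff,
        Finset.coe_subset] at hJ hK
      have h1 : Disjoint S J := Finset.disjoint_sdiff.mono_right hJ
      have h2 : Disjoint S K := Finset.disjoint_sdiff.mono_right hK
      have := congrArg (· \ S) h
      simpa [Finset.union_sdiff_cancel_left h1, Finset.union_sdiff_cancel_left h2] using this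
  have hsplit : ∀ F : Finset α → ℕ, ∑ T ∈ Finset.Icc S Finset.univ, F T =
      F S + ∑ T ∈ Finset.Ioc S Finset.univ, F T := fun F => by
    rw [← Finset.Ioc_insert_left (Finset.subset_univ S), Finset.sum_insert Finset.left_notMem_Ioc]
  have htot' : Fintype.card α ^ (Fintype.card α - S.card) =
      ∑ T ∈ Finset.Icc S Finset.univ, ∑ τ : Equiv.Perm T,
        Fintype.card {f : α → α // core f = ⟨T, τ⟩ ∧ ∀ x : S, f x = σ x} := by
    rw [htot]
    refine (Finset.sum_subset (Finset.subset_univ _) fun T _ hT => hnot T fun h => hT ?_).symm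
    exact Finset.mem_Icc.2 ⟨h, Finset.subset_univ _⟩
  rw [hsplit, hS] at htot'
  have hsum : ∑ T ∈ Finset.Ioc S Finset.univ,
      (T.card - S.card).factorial * (T.card * Fintype.card α ^ (Fintype.card α - T.card)) =
      Fintype.card α * ∑ T ∈ Finset.Ioc S Finset.univ, ∑ τ : Equiv.Perm T,
        Fintype.card {f : α → α // core f = ⟨T, τ⟩ ∧ ∀ x : S, f x = σ x} := by
    rw [Finset.mul_sum]
    exact Finset.sum_congr rfl fun T hT' => (hT T (Finset.mem_Ioc.1 hT').1).symm
  rw [hsplit, hsum, Nat.sub_self, Nat.factorial_zero, one_mul] at hid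
  refine (Nat.add_right_cancel (hid.trans ?_)).symm
  rw [pow_succ, mul_comm, ← mul_add, ← htot']

/-- Sums over mappings with `m` components of a function of the number of cyclic points. -/
theorem sum_numComponents_eq (m : ℕ) (g : ℕ → ℝ) :
    (Fintype.card α : ℝ) * ∑ f : α → α, (if Nat.card (OrbitSpace f) = m then
      g (cyclicPts f).card else 0) =
    ∑ k ∈ Finset.range (Fintype.card α + 1), g k * ((Fintype.card α).choose k *
      Nat.stirlingFirst k m * (k * (Fintype.card α : ℝ) ^ (Fintype.card α - k))) := by
  classical
  have h1 : ∀ (S : Finset α) (σ : Equiv.Perm S), (Fintype.card α : ℝ) *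
      ∑ f : α → α with core f = ⟨S, σ⟩, (if Nat.card (OrbitSpace f) = m then
        g (cyclicPts f).card else 0) = if Nat.card (OrbitSpace σ) = m then
          g S.card * (S.card * (Fintype.card α : ℝ) ^ (Fintype.card α - S.card)) else 0 := by
    intro S σ
    have : ∀ f ∈ ({f | core f = ⟨S, σ⟩} : Finset (α → α)),
        (if Nat.card (OrbitSpace f) = m then g (cyclicPts f).card else 0) =
        (if Nat.card (OrbitSpace σ) = m then g S.card else 0) := by
      intro f hf
      rw [Finset.mem_filter] at hf
      rw [card_orbitSpace_of_core_eq hf.2, (core_eq_iff.1 hf.2).1]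
    rw [Finset.sum_congr rfl this, Finset.sum_const, nsmul_eq_mul, ← Fintype.card_subtype,
      ← mul_assoc, ← Nat.cast_mul, card_core_eq]
    split_ifs
    · push_cast; ring
    · simp
  rw [← Finset.sum_fiberwise_of_maps_to (g := core) (t := Finset.univ)
    (fun _ _ => Finset.mem_univ _), Fintype.sum_sigma]
  have h2 : ∀ S : Finset α, (∑ σ : Equiv.Perm S, if Nat.card (OrbitSpace σ) = m then
      g S.card * (S.card * (Fintype.card α : ℝ) ^ (Fintype.card α - S.card)) else 0) =
      Nat.stirlingFirst S.card m *
        (g S.card * (S.card * (Fintype.card α : ℝ) ^ (Fintype.card α - S.card))) := by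
    intro S
    have := card_perm_orbitSpace S m
    rw [Nat.card_eq_fintype_card, Fintype.card_subtype, Nat.card_eq_fintype_card,
      Fintype.card_coe] at this
    rw [← Finset.sum_filter, Finset.sum_const, nsmul_eq_mul, this]
  rw [Finset.mul_sum, Finset.sum_congr rfl fun S _ => (Finset.mul_sum _ _ _).trans
    ((Finset.sum_congr rfl fun σ _ => h1 S σ).trans (h2 S))]
  -- The summand now depends on `S` only through its size, which produces the binomial coefficient.
  rw [← Finset.powerset_univ, Finset.sum_powerset_apply_card (fun k =>
    (Nat.stirlingFirst k m : ℝ) * (g k * (k * (Fintype.card α : ℝ) ^ (Fintype.card α - k)))),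
    Finset.card_univ]
  refine Finset.sum_congr rfl fun k _ => ?_
  rw [nsmul_eq_mul]
  ring

end Core

/-! ### Slow variation of the normalized Stirling numbers -/

/-- The normalized Stirling number `s(k + 1, r + 1) / k!`. -/
noncomputable def normStirling (r k : ℕ) : ℝ := Nat.stirlingFirst (k + 1) (r + 1) / k.factorial

lemma normStirling_zero_left (k : ℕ) : normStirling 0 k = 1 := by
  rw [normStirling, zero_add, Nat.stirlingFirst_one_right, div_self]
  exact_mod_cast k.factorial_ne_zero

lemma normStirling_nonneg (r k : ℕ) : 0 ≤ normStirling r k := by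
  unfold normStirling; positivity

lemma normStirling_succ (r k : ℕ) :
    normStirling (r + 1) (k + 1) = normStirling (r + 1) k + normStirling r k / (k + 1) := by
  have h1 : (k.factorial : ℝ) ≠ 0 := by exact_mod_cast k.factorial_ne_zero
  have h2 : (k : ℝ) + 1 ≠ 0 := by positivity
  rw [normStirling, normStirling, normStirling, Nat.stirlingFirst_succ_succ (k + 1),
    Nat.factorial_succ]
  push_cast
  field_simp

lemma normStirling_eq_sum (r k : ℕ) :
    normStirling (r + 1) k = ∑ i ∈ Finset.range k, normStirling r i / (i + 1) := by
  induction k with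
  | zero => simp [normStirling, Nat.stirlingFirst_eq_zero_of_lt]
  | succ k ih => rw [normStirling_succ, Finset.sum_range_succ, ih]

lemma normStirling_mono (r : ℕ) : Monotone (normStirling r) := by
  refine monotone_nat_of_le_succ fun k => ?_
  cases r with
  | zero => simp [normStirling_zero_left]
  | succ r =>
    rw [normStirling_succ]
    have := normStirling_nonneg r k
    have : 0 ≤ normStirling r k / (k + 1) := by positivity
    linarith

/-- Comparison with the harmonic series. -/
lemma tendsto_sum_div_of_eventually_le {u : ℕ → ℝ} (h0 : ∀ i, 0 ≤ u i) {c : ℝ} (hc : 0 < c)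
    (h : ∀ᶠ i in atTop, c ≤ u i) :
    Tendsto (fun k => ∑ i ∈ Finset.range k, u i / (i + 1)) atTop atTop := by
  have hnn : ∀ i : ℕ, 0 ≤ u i / ((i : ℝ) + 1) := fun i => by have := h0 i; positivity
  rw [← not_summable_iff_tendsto_nat_atTop_of_nonneg hnn]
  intro hs
  have h1 : Summable fun i : ℕ => 1 / ((i : ℝ) + 1) := by
    refine Summable.of_norm_bounded_eventually_nat (hs.mul_left c⁻¹) ?_
    filter_upwards [h] with i hi
    rw [Real.norm_of_nonneg (by positivity), ← mul_div_assoc]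
    gcongr
    rwa [← div_eq_inv_mul, one_le_div hc]
  refine Real.not_summable_one_div_natCast ((summable_nat_add_iff 1).1 ?_)
  simpa using h1

lemma eventually_normStirling_pos (r : ℕ) :
    ∃ c > 0, ∀ᶠ i in atTop, c ≤ normStirling r i := by
  induction r with
  | zero => exact ⟨1, one_pos, .of_forall fun i => (normStirling_zero_left i).ge⟩
  | succ r ih =>
    obtain ⟨c, hc, h⟩ := ih
    have := tendsto_sum_div_of_eventually_le (normStirling_nonneg r) hc h
    simp only [← normStirling_eq_sum] at this
    exact ⟨1, one_pos, this.eventually_ge_atTop 1⟩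

lemma tendsto_normStirling (r : ℕ) : Tendsto (normStirling (r + 1)) atTop atTop := by
  obtain ⟨c, hc, h⟩ := eventually_normStirling_pos r
  have := tendsto_sum_div_of_eventually_le (normStirling_nonneg r) hc h
  simpa only [← normStirling_eq_sum] using this

/-- Induction through `normStirling_eq_sum`: a little-o relation survives summation when the
dominating nonnegative series diverges. -/
lemma normStirling_isLittleO (r : ℕ) :
    normStirling r =o[atTop] normStirling (r + 1) := by
  induction r with
  | zero =>
    have : normStirling 0 = fun _ => (1 : ℝ) := funext normStirling_zero_left
    rw [this, isLittleO_const_left]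
    exact Or.inr (tendsto_norm_atTop_atTop.comp (tendsto_normStirling 0))
  | succ r ih =>
    have h := (ih.mul_isBigO (isBigO_refl (fun i : ℕ => ((i : ℝ) + 1)⁻¹) atTop)).sum_range
      (fun i => mul_nonneg (normStirling_nonneg _ i) (by positivity)) (by
        have := tendsto_normStirling (r + 1)
        simp only [funext (normStirling_eq_sum (r + 1)), div_eq_mul_inv] at this
        exact this)
    simp only [← div_eq_mul_inv, ← normStirling_eq_sum] at h
    exact h

lemma tendsto_normStirling_div (r : ℕ) :
    Tendsto (fun k => normStirling r k / normStirling (r + 1) k) atTop (𝓝 0) :=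
  (normStirling_isLittleO r).tendsto_div_nhds_zero

/-- `k ↦ normStirling (r + 1) k / (k + 1)` is eventually nonincreasing. -/
lemma exists_normStirling_le_mul (r : ℕ) : ∃ k₀, ∀ l ≥ k₀, ∀ k ≥ l,
    0 < normStirling (r + 1) l ∧
    normStirling (r + 1) k ≤ ((k : ℝ) + 1) / (l + 1) * normStirling (r + 1) l := by
  obtain ⟨k₀, hk₀⟩ := eventually_atTop.1 (((normStirling_isLittleO r).bound one_pos).and
    ((tendsto_normStirling r).eventually_gt_atTop 0))
  refine ⟨k₀, fun l hl k hk => ⟨(hk₀ l hl).2, ?_⟩⟩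
  induction k, hk using Nat.le_induction with
  | base => rw [div_self (by positivity), one_mul]
  | succ k hk ih =>
    have h1 := (hk₀ k (hl.le.trans hk)).1
    rw [Real.norm_of_nonneg (normStirling_nonneg _ _), Real.norm_of_nonneg
      (normStirling_nonneg _ _), one_mul] at h1
    rw [normStirling_succ]
    -- Beyond `k₀` the lower index is dominated by the higher one, so the relative increment is at
    -- most `1 / (k + 1)`, that of `k + 1` itself.
    have h2 : normStirling r k / (k + 1) ≤ normStirling (r + 1) l / (l + 1) := by
      rw [div_mul_eq_mul_div, le_div_iff₀ (by positivity)] at ih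
      rw [div_le_div_iff₀ (by positivity) (by positivity)]
      have : normStirling r k * (l + 1) ≤ normStirling (r + 1) k * (l + 1) := by gcongr
      linarith
    push_cast
    calc _ ≤ ((k : ℝ) + 1) / (l + 1) * normStirling (r + 1) l + normStirling (r + 1) l / (l + 1) :=
          add_le_add ih h2
      _ = _ := by ring

/-- There are `k - l` increments, each at most `normStirling r k / (l + 1)` by monotonicity. For
comparable `l` and `k` this is negligible against `normStirling (r + 1) k`. -/
lemma normStirling_sub_le (r : ℕ) {l k : ℕ} (h : l ≤ k) :
    normStirling (r + 1) k - normStirling (r + 1) l ≤ ((k : ℝ) + 1) / (l + 1) * normStirling r k := by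
  rw [normStirling_eq_sum, normStirling_eq_sum, ← Finset.sum_Ico_eq_sub _ h]
  have : ∀ i ∈ Finset.Ico l k, normStirling r i / ((i : ℝ) + 1) ≤ normStirling r k / (l + 1) := by
    intro i hi
    rw [Finset.mem_Ico] at hi
    have := normStirling_nonneg r k
    have h1 : (l : ℝ) ≤ i := by exact_mod_cast hi.1
    gcongr
    exact normStirling_mono r hi.2.le
  refine (Finset.sum_le_sum this).trans ?_
  rw [Finset.sum_const, Nat.card_Ico, nsmul_eq_mul, Nat.cast_sub h, mul_div_assoc',
    div_mul_eq_mul_div]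
  have := normStirling_nonneg r k
  gcongr
  have : (0 : ℝ) ≤ l := by positivity
  linarith

/-- The normalized Stirling numbers vary slowly. -/
lemma tendsto_normStirling_ratio (r : ℕ) {u v : ℕ → ℕ} (hu : Tendsto u atTop atTop)
    (hv : Tendsto v atTop atTop) {C : ℝ} (huv : ∀ᶠ n in atTop, ((u n : ℝ) + 1) / (v n + 1) ≤ C)
    (hvu : ∀ᶠ n in atTop, ((v n : ℝ) + 1) / (u n + 1) ≤ C) :
    Tendsto (fun n => normStirling (r + 1) (u n) / normStirling (r + 1) (v n)) atTop (𝓝 1) := by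
  set ρ := fun k => normStirling r k / normStirling (r + 1) k with hρ
  have hρ0 : ∀ k, 0 ≤ ρ k := fun k => div_nonneg (normStirling_nonneg _ _) (normStirling_nonneg _ _)
  set e := fun n => C * (ρ (u n) + ρ (v n)) with he
  have he0 : Tendsto e atTop (𝓝 0) := by
    have := (((tendsto_normStirling_div r).comp hu).add
      ((tendsto_normStirling_div r).comp hv)).const_mul C
    simpa using this
  have key : ∀ l k : ℕ, l ≤ k → 0 < normStirling (r + 1) k → 0 < normStirling (r + 1) l →
      ((k : ℝ) + 1) / (l + 1) ≤ C →
      1 - C * ρ k ≤ normStirling (r + 1) l / normStirling (r + 1) k ∧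
      normStirling (r + 1) l / normStirling (r + 1) k ≤ 1 := by
    intro l k hlk hk hl hC
    refine ⟨?_, (div_le_one hk).2 (normStirling_mono _ hlk)⟩
    have h1 := normStirling_sub_le r hlk
    have h2 : ((k : ℝ) + 1) / (l + 1) * normStirling r k ≤ C * normStirling r k :=
      mul_le_mul_of_nonneg_right hC (normStirling_nonneg _ _)
    rw [le_div_iff₀ hk, sub_mul, one_mul, mul_assoc, hρ]
    simp only
    rw [div_mul_cancel₀ _ hk.ne']
    linarith
  have hev := ((((hu.eventually ((tendsto_normStirling r).eventually_gt_atTop 0)).and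
    (hv.eventually ((tendsto_normStirling r).eventually_gt_atTop 0))).and huv).and hvu).and
    (he0.eventually_lt_const one_pos)
  have hlow : Tendsto (fun n => 1 - e n) atTop (𝓝 1) := by simpa using he0.const_sub 1
  have hupp : Tendsto (fun n => (1 - e n)⁻¹) atTop (𝓝 1) := by
    simpa using hlow.inv₀ one_ne_zero
  refine tendsto_of_tendsto_of_tendsto_of_le_of_le' hlow hupp ?_ ?_
  all_goals
    filter_upwards [hev] with n hn
    obtain ⟨⟨⟨⟨hup, hvp⟩, huv⟩, hvu⟩, he1⟩ := hn
    have hC : 0 ≤ C := le_trans (by positivity) huv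
    have hee : 0 ≤ e n := mul_nonneg hC (add_nonneg (hρ0 _) (hρ0 _))
    have hu' : C * ρ (u n) ≤ e n := mul_le_mul_of_nonneg_left (by linarith [hρ0 (v n)]) hC
    have hv' : C * ρ (v n) ≤ e n := mul_le_mul_of_nonneg_left (by linarith [hρ0 (u n)]) hC
    have hone : 1 ≤ (1 - e n)⁻¹ := (one_le_inv₀ (by linarith)).2 (by linarith)
    -- `key` needs the smaller index in the numerator; in the other order it bounds the inverse
    -- ratio.
    rcases le_total (u n) (v n) with h | h
    · obtain ⟨h1, h2⟩ := key _ _ h hvp hup hvu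
      linarith
    · obtain ⟨h1, h2⟩ := key _ _ h hup hvp huv
      have h3 : 1 - e n ≤ (normStirling (r + 1) (u n) / normStirling (r + 1) (v n))⁻¹ := by
        rw [inv_div]; linarith
      have h4 : 1 ≤ normStirling (r + 1) (u n) / normStirling (r + 1) (v n) := by
        rw [one_le_div hvp]; exact normStirling_mono _ h
      have h5 := (le_inv_comm₀ (by linarith) (by linarith)).1 h3
      linarith

/-! ### Gaussian limit of the falling factorial weight -/

/-- The falling factorial weight `n (n - 1) ⋯ (n - k) / n ^ (k + 1)`. -/
noncomputable def fallWeight (n k : ℕ) : ℝ := n.descFactorial (k + 1) / (n : ℝ) ^ (k + 1)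

lemma fallWeight_nonneg (n k : ℕ) : 0 ≤ fallWeight n k := by unfold fallWeight; positivity

lemma fallWeight_eq_zero {n k : ℕ} (h : n ≤ k) : fallWeight n k = 0 := by
  rw [fallWeight, Nat.descFactorial_eq_zero_iff_lt.2 (by omega)]
  simp

lemma fallWeight_zero {n : ℕ} (hn : 0 < n) : fallWeight n 0 = 1 := by
  have : (n : ℝ) ≠ 0 := by positivity
  simp [fallWeight, this]

lemma fallWeight_succ {n : ℕ} (k : ℕ) :
    fallWeight n (k + 1) = fallWeight n k * (((n - (k + 1) : ℕ) : ℝ) / n) := by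
  rw [fallWeight, fallWeight, Nat.descFactorial_succ n (k + 1), pow_succ]
  push_cast
  rw [div_mul_div_comm]
  ring

lemma fallWeight_le {n : ℕ} (hn : 0 < n) (k : ℕ) :
    fallWeight n k ≤ Real.exp (-((k : ℝ) * (k + 1) / (2 * n))) := by
  have hn' : (0 : ℝ) < n := by positivity
  induction k with
  | zero => simp [fallWeight_zero hn]
  | succ k ih =>
    rw [fallWeight_succ]
    have h1 : (((n - (k + 1) : ℕ) : ℝ) / n) ≤ Real.exp (-(((k : ℝ) + 1) / n)) := by
      rcases le_total (k + 1) n with h | h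
      · rw [Nat.cast_sub h, sub_div, div_self hn'.ne']
        have := Real.add_one_le_exp (-(((k : ℝ) + 1) / n))
        push_cast
        linarith
      · rw [Nat.sub_eq_zero_of_le h]
        simp [Real.exp_nonneg]
    refine (mul_le_mul ih h1 (by positivity) (Real.exp_nonneg _)).trans_eq ?_
    rw [← Real.exp_add]
    congr 1
    push_cast
    field_simp
    ring

/-- From `1 + t ≤ exp t` and `(1 + u + 2u²)(1 - u) = 1 + u²(1 - 2u) ≥ 1`. -/
lemma exp_le_one_sub {u : ℝ} (h1 : u ≤ 1 / 2) :
    Real.exp (-(u + 2 * u ^ 2)) ≤ 1 - u := by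
  rw [Real.exp_neg, inv_le_comm₀ (Real.exp_pos _) (by linarith), inv_le_iff_one_le_mul₀ (by linarith)]
  have := Real.add_one_le_exp (u + 2 * u ^ 2)
  calc (1 : ℝ) ≤ (u + 2 * u ^ 2 + 1) * (1 - u) := by nlinarith [sq_nonneg u]
    _ ≤ _ := by gcongr; linarith

/-- The weight is the product of `1 - i / n` over `i ≤ k`; apply `exp_le_one_sub` to each factor and
bound the sum of `i²` by `k³`. The cubic error is `O(1 / √n)` when `k` is of order `√n`. -/
lemma le_fallWeight {n : ℕ} (hn : 0 < n) (k : ℕ) (hk : 2 * k ≤ n) :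
    Real.exp (-((k : ℝ) * (k + 1) / (2 * n) + 2 * k ^ 3 / n ^ 2)) ≤ fallWeight n k := by
  have hn' : (0 : ℝ) < n := by positivity
  induction k with
  | zero => simp [fallWeight_zero hn]
  | succ k ih =>
    rw [fallWeight_succ, Nat.cast_sub (by omega), sub_div, div_self hn'.ne']
    have hk' : 2 * ((k : ℝ) + 1) ≤ n := by exact_mod_cast hk
    have h1 := exp_le_one_sub (u := ((k : ℝ) + 1) / n) (by
      rw [div_le_div_iff₀ hn' two_pos]; linarith)
    push_cast
    refine le_trans ?_ (mul_le_mul (ih (by omega)) h1 (Real.exp_nonneg _) (fallWeight_nonneg _ _))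
    rw [← Real.exp_add, Real.exp_le_exp]
    have h2 : 2 * (k : ℝ) ^ 3 / n ^ 2 + 2 * ((k + 1) / n) ^ 2 ≤ 2 * ((k : ℝ) + 1) ^ 3 / n ^ 2 := by
      rw [div_pow, mul_div_assoc', ← add_div]
      gcongr
      have : (0 : ℝ) ≤ k := by positivity
      nlinarith [mul_nonneg this this]
    have h3 : ((k : ℝ) + 1) * (k + 1 + 1) / (2 * n) = k * (k + 1) / (2 * n) + (k + 1) / n := by
      field_simp; ring
    linarith

lemma tendsto_floor_mul_sqrt_div {x : ℝ} (hx : 0 ≤ x) :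
    Tendsto (fun n : ℕ => (⌊x * √(n : ℝ)⌋₊ : ℝ) / √(n : ℝ)) atTop (𝓝 x) :=
  (tendsto_nat_floor_mul_div_atTop hx).comp
    (Real.tendsto_sqrt_atTop.comp tendsto_natCast_atTop_atTop)

lemma tendsto_sqrt_natCast : Tendsto (fun n : ℕ => √(n : ℝ)) atTop atTop :=
  Real.tendsto_sqrt_atTop.comp tendsto_natCast_atTop_atTop

lemma tendsto_inv_sqrt_natCast : Tendsto (fun n : ℕ => (√(n : ℝ))⁻¹) atTop (𝓝 0) :=
  tendsto_inv_atTop_zero.comp tendsto_sqrt_natCast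

lemma tendsto_fallWeight {x : ℝ} (hx : 0 ≤ x) :
    Tendsto (fun n : ℕ => fallWeight n ⌊x * √(n : ℝ)⌋₊) atTop (𝓝 (Real.exp (-(x ^ 2 / 2)))) := by
  set q := fun n : ℕ => (⌊x * √(n : ℝ)⌋₊ : ℝ) / √(n : ℝ) with hq
  have hqx : Tendsto q atTop (𝓝 x) := tendsto_floor_mul_sqrt_div hx
  have hE : Tendsto (fun n : ℕ => q n * (q n + (√(n : ℝ))⁻¹) / 2) atTop (𝓝 (x ^ 2 / 2)) := by
    have := (hqx.mul (hqx.add tendsto_inv_sqrt_natCast)).div_const 2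
    simpa [sq] using this
  have hR : Tendsto (fun n : ℕ => 2 * q n ^ 3 * (√(n : ℝ))⁻¹) atTop (𝓝 0) := by
    have := ((hqx.pow 3).const_mul 2).mul tendsto_inv_sqrt_natCast
    simpa using this
  have hsq : ∀ n : ℕ, 0 < n → ∃ s : ℝ, 0 < s ∧ √(n : ℝ) = s ∧ (n : ℝ) = s ^ 2 := fun n hn =>
    ⟨√(n : ℝ), Real.sqrt_pos.2 (by positivity), rfl, (Real.sq_sqrt (by positivity)).symm⟩
  have hsmall : ∀ᶠ n : ℕ in atTop, 2 * ⌊x * √(n : ℝ)⌋₊ ≤ n := by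
    have : Tendsto (fun n : ℕ => 2 * (q n * (√(n : ℝ))⁻¹)) atTop (𝓝 0) := by
      simpa using (hqx.mul tendsto_inv_sqrt_natCast).const_mul 2
    filter_upwards [this.eventually_lt_const one_pos, eventually_gt_atTop 0] with n hn hn0
    obtain ⟨s, hs, hs1, hs2⟩ := hsq n hn0
    simp only [hq, hs1] at hn ⊢
    have h : 2 * (⌊x * s⌋₊ : ℝ) ≤ n := by
      rw [hs2]
      have : 2 * ((⌊x * s⌋₊ : ℝ) / s * s⁻¹) = 2 * (⌊x * s⌋₊ : ℝ) / s ^ 2 := by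
        field_simp
      rw [this, div_lt_one (by positivity)] at hn
      exact hn.le
    exact_mod_cast h
  refine tendsto_of_tendsto_of_tendsto_of_le_of_le'
    (g := fun n : ℕ => Real.exp (-(q n * (q n + (√(n : ℝ))⁻¹) / 2 + 2 * q n ^ 3 * (√(n : ℝ))⁻¹)))
    (h := fun n : ℕ => Real.exp (-(q n * (q n + (√(n : ℝ))⁻¹) / 2))) ?_ ?_ ?_ ?_
  · have := Real.continuous_exp.continuousAt.tendsto.comp (hE.add hR).neg
    simpa [Function.comp_def] using this
  · exact Real.continuous_exp.continuousAt.tendsto.comp hE.neg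
  · filter_upwards [hsmall, eventually_gt_atTop 0] with n hn hn0
    refine le_trans (le_of_eq ?_) (le_fallWeight hn0 _ hn)
    obtain ⟨s, hs, hs1, hs2⟩ := hsq n hn0
    simp only [hq, hs1]
    rw [hs2]
    congr 2
    field_simp
  · filter_upwards [eventually_gt_atTop 0] with n hn0
    refine (fallWeight_le hn0 _).trans (le_of_eq ?_)
    obtain ⟨s, hs, hs1, hs2⟩ := hsq n hn0
    simp only [hq, hs1]
    rw [hs2]
    congr 2
    field_simp

/-! ### Moment sums as integrals, and dominated convergence -/

lemma setIntegral_floor (n : ℕ) (h : ℕ → ℝ) (h0 : ∀ k, n ≤ k → h k = 0) :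
    ∫ x in Set.Ioi (0 : ℝ), h ⌊x⌋₊ = ∑ k ∈ Finset.range n, h k := by
  have hae : ∀ k : ℕ, ∀ᵐ x : ℝ, x ∈ Set.uIoc (k : ℝ) (k + 1 : ℕ) → h ⌊x⌋₊ = h k := by
    intro k
    -- The right endpoint has floor `k + 1`, hence only an almost-everywhere equality.
    filter_upwards [Measure.ae_ne volume ((k + 1 : ℕ) : ℝ)] with x hx hx'
    rw [Set.uIoc_of_le (by simp)] at hx'
    rw [(Nat.floor_eq_iff (le_trans (by positivity) hx'.1.le)).2
      ⟨hx'.1.le, lt_of_le_of_ne (by exact_mod_cast hx'.2) (by exact_mod_cast hx)⟩]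
  have hint : ∀ k < n, IntervalIntegrable (fun x : ℝ => h ⌊x⌋₊) volume (k : ℕ) (k + 1 : ℕ) := by
    intro k _
    refine (intervalIntegrable_const (c := h k)).congr_ae ?_
    rw [Filter.EventuallyEq, ae_restrict_iff' measurableSet_uIoc]
    filter_upwards [hae k] with x hx hx'
    exact (hx hx').symm
  rw [setIntegral_eq_of_subset_of_forall_sdiff_eq_zero (s := Set.Ioc (0 : ℝ) n) measurableSet_Ioi
    Set.Ioc_subset_Ioi_self, ← intervalIntegral.integral_of_le (by positivity), ← Nat.cast_zero,
    ← intervalIntegral.sum_integral_adjacent_intervals hint]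
  · refine Finset.sum_congr rfl fun k _ => ?_
    rw [intervalIntegral.integral_congr_ae (g := fun _ => h k) (hae k)]
    simp
  · intro x hx
    refine h0 _ (Nat.le_floor (le_of_lt ?_))
    by_contra hlt
    exact hx.2 ⟨hx.1, not_lt.1 hlt⟩

/-- The integrand whose integral is the rescaled `j`-th moment sum. -/
noncomputable def scaledTerm (r j n k : ℕ) : ℝ :=
  (((k : ℝ) + 1) / √(n : ℝ)) ^ j * fallWeight n k *
    (normStirling (r + 1) k / normStirling (r + 1) ⌊√(n : ℝ)⌋₊)

lemma tendsto_floor_mul_sqrt {x : ℝ} (hx : 0 < x) :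
    Tendsto (fun n : ℕ => ⌊x * √(n : ℝ)⌋₊) atTop atTop :=
  tendsto_nat_floor_atTop.comp (tendsto_sqrt_natCast.const_mul_atTop hx)

lemma tendsto_floor_sqrt : Tendsto (fun n : ℕ => ⌊√(n : ℝ)⌋₊) atTop atTop :=
  tendsto_nat_floor_atTop.comp tendsto_sqrt_natCast

lemma tendsto_scaledTerm (r j : ℕ) {x : ℝ} (hx : 0 < x) :
    Tendsto (fun n : ℕ => scaledTerm r j n ⌊x * √(n : ℝ)⌋₊) atTop
      (𝓝 (x ^ j * Real.exp (-(x ^ 2 / 2)))) := by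
  have h1 : Tendsto (fun n : ℕ => ((⌊x * √(n : ℝ)⌋₊ : ℝ) + 1) / √(n : ℝ)) atTop (𝓝 x) := by
    have := (tendsto_floor_mul_sqrt_div hx.le).add tendsto_inv_sqrt_natCast
    simpa [add_div] using this
  have h2 := tendsto_fallWeight hx.le
  have h3 : Tendsto (fun n : ℕ => normStirling (r + 1) ⌊x * √(n : ℝ)⌋₊ /
      normStirling (r + 1) ⌊√(n : ℝ)⌋₊) atTop (𝓝 1) := by
    refine tendsto_normStirling_ratio r (tendsto_floor_mul_sqrt hx) tendsto_floor_sqrt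
      (C := (x + 1) + 2 / x) ?_ ?_
    all_goals
      filter_upwards [tendsto_sqrt_natCast.eventually_ge_atTop 1] with n hn
      set s := √(n : ℝ)
      have hu1 := Nat.lt_floor_add_one (x * s)
      have hu2 := Nat.floor_le (a := x * s) (by positivity)
      have hv1 := Nat.lt_floor_add_one s
      have hv2 := Nat.floor_le (a := s) (by positivity)
      have hx2 : 0 < 2 / x := by positivity
    · refine le_trans (b := x + 1) ?_ (by linarith)
      rw [div_le_iff₀ (by positivity)]
      nlinarith
    · refine le_trans (b := 2 / x) ?_ (by linarith)
      rw [div_le_div_iff₀ (by positivity) hx]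
      nlinarith
  have := ((h1.pow j).mul h2).mul h3
  rw [mul_one] at this
  exact this

/-- The power contributes at most `(x + 1) ^ j`, the Stirling ratio at most `x + 1` by its sublinear
growth, and the weight at most `exp (-x² / 2 + x / 2)`. -/
lemma eventually_norm_scaledTerm_le (r j : ℕ) : ∀ᶠ n : ℕ in atTop, ∀ x : ℝ, 0 < x →
    ‖scaledTerm r j n ⌊x * √(n : ℝ)⌋₊‖ ≤
      ((j + 1).factorial * Real.exp (13 / 4)) * Real.exp (-(1 / 4) * x ^ 2) := by
  obtain ⟨k₀, hk₀⟩ := exists_normStirling_le_mul r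
  filter_upwards [tendsto_sqrt_natCast.eventually_ge_atTop 1, eventually_gt_atTop 0,
    tendsto_floor_sqrt.eventually_ge_atTop k₀] with n hn hn0 hnk x hx
  have hfn := fallWeight_nonneg n ⌊x * √(n : ℝ)⌋₊
  have hb := normStirling_nonneg (r + 1) ⌊x * √(n : ℝ)⌋₊
  have hb' := (hk₀ _ hnk _ le_rfl).1
  rw [scaledTerm, Real.norm_of_nonneg (by positivity)]
  have hns : (n : ℝ) = √(n : ℝ) ^ 2 := (Real.sq_sqrt (by positivity)).symm
  have hw := fallWeight_le hn0 ⌊x * √(n : ℝ)⌋₊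
  set s := √(n : ℝ) with hs
  have hs0 : 0 < s := by linarith
  have hu1 := Nat.lt_floor_add_one (x * s)
  have hu2 := Nat.floor_le (a := x * s) (by positivity)
  have hv1 := Nat.lt_floor_add_one s
  have hxs : 0 < x * s := by positivity
  have h1 : ((⌊x * s⌋₊ : ℝ) + 1) / s ≤ x + 1 := by
    rw [div_le_iff₀ hs0]; nlinarith
  have h3 : normStirling (r + 1) ⌊x * s⌋₊ / normStirling (r + 1) ⌊s⌋₊ ≤ x + 1 := by
    rw [div_le_iff₀ hb']
    rcases le_total ⌊s⌋₊ ⌊x * s⌋₊ with h | h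
    · refine (hk₀ _ hnk _ h).2.trans (mul_le_mul_of_nonneg_right ?_ hb'.le)
      rw [div_le_iff₀ (by positivity)]
      nlinarith
    · have := normStirling_mono (r + 1) h
      nlinarith
  have h2 : fallWeight n ⌊x * s⌋₊ ≤ Real.exp (-(x ^ 2 / 2) + x / 2) := by
    refine hw.trans (Real.exp_le_exp.2 ?_)
    have : x ^ 2 / 2 - x / 2 ≤ (⌊x * s⌋₊ : ℝ) * (⌊x * s⌋₊ + 1) / (2 * n) := by
      rw [le_div_iff₀ (by positivity), hns]
      have hle : (x * s - 1) * (x * s) ≤ (⌊x * s⌋₊ : ℝ) * (⌊x * s⌋₊ + 1) := by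
        rcases le_total (x * s) 1 with h | h
        · have : (x * s - 1) * (x * s) ≤ 0 := mul_nonpos_of_nonpos_of_nonneg (by linarith) hxs.le
          exact this.trans (by positivity)
        · exact mul_le_mul (by linarith) hu1.le hxs.le (by positivity)
      nlinarith [mul_nonneg (mul_nonneg hx.le hs0.le) (sub_nonneg.2 hn)]
    linarith
  have h4 : (x + 1) ^ (j + 1) ≤ (j + 1).factorial * Real.exp (x + 1) := by
    have := Real.pow_div_factorial_le_exp (x + 1) (by linarith) (j + 1)
    rwa [div_le_iff₀ (by positivity), mul_comm] at this
  have hpos : 0 ≤ ((⌊x * s⌋₊ : ℝ) + 1) / s := by positivity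
  calc _ ≤ (x + 1) ^ j * Real.exp (-(x ^ 2 / 2) + x / 2) * (x + 1) := by gcongr
    _ = (x + 1) ^ (j + 1) * Real.exp (-(x ^ 2 / 2) + x / 2) := by ring
    _ ≤ ((j + 1).factorial * Real.exp (x + 1)) * Real.exp (-(x ^ 2 / 2) + x / 2) := by gcongr
    _ ≤ _ := by
      rw [mul_assoc, mul_assoc, ← Real.exp_add, ← Real.exp_add]
      refine mul_le_mul_of_nonneg_left (Real.exp_le_exp.2 ?_) (by positivity)
      -- The constant `13 / 4` comes from `1 + 3x/2 - x²/2 = 13/4 - x²/4 - (x - 3)²/4`.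
      nlinarith [sq_nonneg (x - 3)]

/-- The rescaled moment sums converge to Gaussian moments on the half-line. -/
theorem tendsto_sum_scaledTerm (r j : ℕ) :
    Tendsto (fun n : ℕ => (√(n : ℝ))⁻¹ * ∑ k ∈ Finset.range n, scaledTerm r j n k) atTop
      (𝓝 (∫ x in Set.Ioi (0 : ℝ), x ^ j * Real.exp (-(x ^ 2 / 2)))) := by
  have hint : ∀ᶠ n : ℕ in atTop, ∫ x in Set.Ioi (0 : ℝ), scaledTerm r j n ⌊x * √(n : ℝ)⌋₊ =
      (√(n : ℝ))⁻¹ * ∑ k ∈ Finset.range n, scaledTerm r j n k := by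
    filter_upwards [eventually_gt_atTop 0] with n hn
    rw [integral_comp_mul_right_Ioi (fun y => scaledTerm r j n ⌊y⌋₊) 0
      (Real.sqrt_pos.2 (by positivity)), zero_mul, setIntegral_floor n, smul_eq_mul]
    intro k hk
    simp [scaledTerm, fallWeight_eq_zero hk]
  refine Tendsto.congr' hint ?_
  refine tendsto_integral_filter_of_dominated_convergence
    (fun x => ((j + 1).factorial * Real.exp (13 / 4)) * Real.exp (-(1 / 4) * x ^ 2)) ?_ ?_ ?_ ?_
  · refine .of_forall fun n => Measurable.aestronglyMeasurable ?_
    exact (measurable_of_countable (scaledTerm r j n)).comp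
      (Nat.measurable_floor.comp (measurable_id.mul_const _))
  · filter_upwards [eventually_norm_scaledTerm_le r j] with n hn
    filter_upwards [ae_restrict_mem measurableSet_Ioi] with x hx
    exact hn x hx
  · exact ((integrable_exp_neg_mul_sq (by norm_num)).const_mul _).integrableOn
  · filter_upwards [ae_restrict_mem measurableSet_Ioi] with x hx
    exact tendsto_scaledTerm r j hx

/-! ### Moment sums and half-line Gaussian moments -/

/-- The `j`-th moment sum. -/
noncomputable def momentSum (r j n : ℕ) : ℝ :=
  ∑ k ∈ Finset.range n, ((k : ℝ) + 1) ^ j * (fallWeight n k * normStirling (r + 1) k)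

/-- The `j`-th moment of the half-line Gaussian weight. -/
noncomputable def gaussMoment (j : ℕ) : ℝ :=
  ∫ x in Set.Ioi (0 : ℝ), x ^ j * Real.exp (-(x ^ 2 / 2))

lemma gaussMoment_eq (j : ℕ) : gaussMoment j =
    (1 / 2 : ℝ) ^ (-((j : ℝ) + 1) / 2) * (1 / 2) * Real.Gamma (((j : ℝ) + 1) / 2) := by
  rw [← integral_rpow_mul_exp_neg_mul_rpow two_pos (by have := j.cast_nonneg (α := ℝ); linarith)
    (by norm_num), gaussMoment]
  refine setIntegral_congr_fun measurableSet_Ioi fun x hx => ?_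
  simp only [Real.rpow_natCast, Real.rpow_two]
  congr 2
  ring

lemma half_rpow_neg_half : (1 / 2 : ℝ) ^ (-(1 / 2) : ℝ) = √2 := by
  rw [one_div, Real.inv_rpow two_pos.le, Real.rpow_neg two_pos.le, inv_inv, Real.sqrt_eq_rpow, one_div]

lemma gaussMoment_zero : gaussMoment 0 = √(Real.pi / 2) := by
  rw [gaussMoment_eq]
  have : (-(((0 : ℕ) : ℝ) + 1) / 2) = -(1 / 2) := by norm_num
  rw [this, half_rpow_neg_half]
  norm_num [Real.Gamma_one_half_eq]
  have h2 : √2 * √2 = (2 : ℝ) := Real.mul_self_sqrt two_pos.le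
  have : √2 ≠ (0 : ℝ) := by positivity
  field_simp
  linarith

lemma gaussMoment_one : gaussMoment 1 = 1 := by
  rw [gaussMoment_eq]
  norm_num [Real.rpow_neg_one]

/-- The functional equation of `Γ` at `1/2`; this equality is what makes the second moment
asymptotic to exactly `n`. -/
lemma gaussMoment_two : gaussMoment 2 = gaussMoment 0 := by
  rw [gaussMoment_eq, gaussMoment_eq]
  have h : (((2 : ℕ) : ℝ) + 1) / 2 = 1 / 2 + 1 := by norm_num
  have h' : (((0 : ℕ) : ℝ) + 1) / 2 = 1 / 2 := by norm_num
  rw [neg_div, neg_div, h, h', Real.Gamma_add_one (by norm_num), neg_add,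
    Real.rpow_add (by norm_num), Real.rpow_neg_one]
  ring

lemma gaussMoment_zero_pos : 0 < gaussMoment 0 := by
  rw [gaussMoment_zero]; positivity

lemma scaledTerm_sum_eq (r j n : ℕ) :
    (√(n : ℝ))⁻¹ * ∑ k ∈ Finset.range n, scaledTerm r j n k =
      momentSum r j n / (√(n : ℝ) ^ (j + 1) * normStirling (r + 1) ⌊√(n : ℝ)⌋₊) := by
  rw [momentSum, Finset.sum_div, Finset.mul_sum]
  refine Finset.sum_congr rfl fun k _ => ?_
  rw [scaledTerm, div_pow, pow_succ, div_eq_mul_inv, div_eq_mul_inv, div_eq_mul_inv, mul_inv,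
    mul_inv]
  ring

lemma tendsto_momentSum (r j : ℕ) :
    Tendsto (fun n : ℕ => momentSum r j n /
      (√(n : ℝ) ^ (j + 1) * normStirling (r + 1) ⌊√(n : ℝ)⌋₊)) atTop (𝓝 (gaussMoment j)) := by
  simpa only [scaledTerm_sum_eq, gaussMoment] using tendsto_sum_scaledTerm r j

lemma eventually_momentSum_zero_pos (r : ℕ) : ∀ᶠ n in atTop, 0 < momentSum r 0 n := by
  filter_upwards [(tendsto_momentSum r 0).eventually_const_lt gaussMoment_zero_pos,
    tendsto_floor_sqrt.eventually ((tendsto_normStirling r).eventually_gt_atTop 0)] with n h1 h2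
  have : 0 < √(n : ℝ) ^ (0 + 1) * normStirling (r + 1) ⌊√(n : ℝ)⌋₊ := by
    refine lt_of_le_of_ne (by positivity) fun h => ?_
    rw [← h, div_zero] at h1
    exact lt_irrefl _ h1
  exact (div_pos_iff_of_pos_right this).1 h1

/-- Ratios of moment sums. -/
theorem tendsto_momentSum_ratio (r j : ℕ) :
    Tendsto (fun n : ℕ => momentSum r j n / momentSum r 0 n / √(n : ℝ) ^ j) atTop
      (𝓝 (gaussMoment j / gaussMoment 0)) := by
  refine ((tendsto_momentSum r j).div (tendsto_momentSum r 0) gaussMoment_zero_pos.ne').congr' ?_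
  filter_upwards [tendsto_sqrt_natCast.eventually_gt_atTop 0,
    tendsto_floor_sqrt.eventually ((tendsto_normStirling r).eventually_gt_atTop 0),
    eventually_momentSum_zero_pos r] with n h1 h2 h3
  simp only [Pi.div_apply]
  field_simp
  ring

/-! ### Transfer to the conditioned law -/

lemma numCyclic_eq {n : ℕ} (f : Fin n → Fin n) : numCyclic f = (cyclicPts f).card := by
  rw [numCyclic, ← Set.ncard_coe_finset]
  congr 1
  ext x
  simp [mem_cyclicPts]

lemma sum_numCyclic_eq_momentSum (r j n : ℕ) :
    (n : ℝ) * ∑ f : Fin n → Fin n, (if numComponents f = r + 2 then (numCyclic f : ℝ) ^ j else 0) =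
      (n : ℝ) ^ n * momentSum r j n := by
  have h := sum_numComponents_eq (α := Fin n) (r + 2) (fun k => (k : ℝ) ^ j)
  simp only [← numComponents_eq, ← numCyclic_eq, Fintype.card_fin] at h
  -- The `k = 0` term vanishes through its factor `k`; the rest is reindexed by `k + 1` cyclic
  -- points.
  rw [h, Finset.sum_range_succ', momentSum, Finset.mul_sum]
  simp only [CharP.cast_eq_zero, zero_mul, mul_zero, add_zero]
  refine Finset.sum_congr rfl fun k hk => ?_
  rw [Finset.mem_range] at hk
  have hn : (n : ℝ) ≠ 0 := by
    have : 0 < n := by omega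
    positivity
  have hk0 : (k.factorial : ℝ) ≠ 0 := by exact_mod_cast k.factorial_ne_zero
  have hpow : (n : ℝ) ^ n = n ^ (n - (k + 1)) * n ^ (k + 1) := by
    rw [← pow_add, Nat.sub_add_cancel hk]
  rw [fallWeight, normStirling, Nat.descFactorial_eq_factorial_mul_choose, Nat.factorial_succ, hpow]
  push_cast
  field_simp

lemma mappingLaw_eq (n m : ℕ) :
    mappingLaw n m = Measure.count[|{f : Fin n → Fin n | numComponents f = m}] := by
  rw [mappingLaw, uniformOn, cond_cond_eq_cond_inter' .univ .of_discrete
    (Measure.count_apply_lt_top.2 Set.finite_univ).ne, Set.univ_inter]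

/-- Valid even when no mapping has `m` components: the law is then the zero measure and the quotient
is `0 / 0 = 0`. -/
lemma integral_mappingLaw (n m : ℕ) (g : (Fin n → Fin n) → ℝ) :
    ∫ f, g f ∂(mappingLaw n m) = (∑ f, if numComponents f = m then g f else 0) /
      ∑ f : Fin n → Fin n, if numComponents f = m then (1 : ℝ) else 0 := by
  classical
  rw [mappingLaw_eq, ProbabilityTheory.cond, integral_smul_measure, ← integral_indicator .of_discrete,
    integral_fintype .of_finite, div_eq_inv_mul, smul_eq_mul]
  congr 1
  · rw [ENNReal.toReal_inv, Finset.sum_boole]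
    congr 1
    have : {f : Fin n → Fin n | numComponents f = m} =
      (({f | numComponents f = m} : Finset (Fin n → Fin n)) : Set (Fin n → Fin n)) := by ext; simp
    rw [this, Measure.count_apply_finset]
    simp
  · refine Finset.sum_congr rfl fun f _ => ?_
    simp [Measure.real, Set.indicator_apply]

lemma moment_eq (r j : ℕ) {n : ℕ} (hn : 0 < n) :
    ∫ f, (numCyclic f : ℝ) ^ j ∂(mappingLaw n (r + 2)) = momentSum r j n / momentSum r 0 n := by
  have h0 := sum_numCyclic_eq_momentSum r 0 n
  have hj := sum_numCyclic_eq_momentSum r j n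
  simp only [pow_zero] at h0
  have hn' : (n : ℝ) ≠ 0 := by positivity
  rw [integral_mappingLaw, ← mul_div_mul_left _ _ hn', h0, hj,
    mul_div_mul_left _ _ (pow_ne_zero _ hn')]

theorem tendsto_moment (r j : ℕ) :
    Tendsto (fun n : ℕ => (∫ f, (numCyclic f : ℝ) ^ j ∂(mappingLaw n (r + 2))) / √(n : ℝ) ^ j) atTop
      (𝓝 (gaussMoment j / gaussMoment 0)) := by
  refine (tendsto_momentSum_ratio r j).congr' ?_
  filter_upwards [eventually_gt_atTop 0] with n hn
  rw [moment_eq r j hn]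

/-- Up to a positive factor, the zeroth moment sum counts the mappings in the conditioning event, so
its positivity makes the event nonempty. The formula `E(N²) - E(N)²` for the variance relies on
this. -/
lemma isProbabilityMeasure_mappingLaw {n r : ℕ} (hn : 0 < n) (h : 0 < momentSum r 0 n) :
    IsProbabilityMeasure (mappingLaw n (r + 2)) := by
  rw [mappingLaw_eq]
  refine cond_isProbabilityMeasure fun hA => ?_
  rw [Measure.count_eq_zero_iff] at hA
  have h0 := sum_numCyclic_eq_momentSum r 0 n
  have hz : ∀ f : Fin n → Fin n, ¬ numComponents f = r + 2 := fun f hf =>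
    Set.eq_empty_iff_forall_notMem.1 hA f hf
  simp only [hz, if_false, Finset.sum_const_zero, mul_zero] at h0
  have : 0 < (n : ℝ) ^ n * momentSum r 0 n := by positivity
  linarith

lemma gaussMoment_ratio_one : gaussMoment 1 / gaussMoment 0 = √(2 / Real.pi) := by
  rw [gaussMoment_one, gaussMoment_zero, ← inv_div Real.pi 2, Real.sqrt_inv, one_div]

end RandomMapping

theorem mainTheorem4 (m : ℕ) (hm : 2 ≤ m) :
    ((fun n : ℕ => ∫ f, (RandomMapping.numCyclic f : ℝ) ∂(RandomMapping.mappingLaw n m))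
      ~[atTop] (fun n : ℕ => Real.sqrt (2 * (n : ℝ) / Real.pi))) ∧
    ((fun n : ℕ => ∫ f, (RandomMapping.numCyclic f : ℝ) ^ 2 ∂(RandomMapping.mappingLaw n m))
      ~[atTop] (fun n : ℕ => (n : ℝ))) ∧
    ((fun n : ℕ => variance (fun f => (RandomMapping.numCyclic f : ℝ))
        (RandomMapping.mappingLaw n m))
      ~[atTop] (fun n : ℕ => (1 - 2 / Real.pi) * (n : ℝ))) := by
  obtain ⟨r, rfl⟩ := Nat.exists_eq_add_of_le' hm
  have h1 := RandomMapping.tendsto_moment r 1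
  have h2 := RandomMapping.tendsto_moment r 2
  rw [RandomMapping.gaussMoment_ratio_one] at h1
  rw [RandomMapping.gaussMoment_two, div_self RandomMapping.gaussMoment_zero_pos.ne'] at h2
  simp only [pow_one] at h1
  simp only [Real.sq_sqrt (Nat.cast_nonneg _)] at h2
  have hc : 0 < √(2 / Real.pi) := Real.sqrt_pos.2 (by positivity)
  have hc2 : 0 < 1 - 2 / Real.pi := by
    rw [sub_pos, div_lt_one Real.pi_pos]
    linarith [Real.pi_gt_three]
  refine ⟨?_, ?_, ?_⟩
  · refine isEquivalent_of_tendsto_one ?_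
    have := h1.div_const √(2 / Real.pi)
    rw [div_self hc.ne'] at this
    refine this.congr fun n => ?_
    simp only [Pi.div_apply]
    rw [div_div, ← Real.sqrt_mul (Nat.cast_nonneg _), mul_div_assoc', mul_comm (n : ℝ)]
  · exact isEquivalent_of_tendsto_one h2
  · refine isEquivalent_of_tendsto_one ?_
    -- Subtracting the two limits yields an asymptotic equivalent only because `1 - 2/π` is nonzero
    -- (`hc2`).
    have h3 := (h2.sub (h1.pow 2)).div_const (1 - 2 / Real.pi)
    rw [Real.sq_sqrt (by positivity), div_self hc2.ne'] at h3
    refine h3.congr' ?_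
    filter_upwards [eventually_gt_atTop 0, RandomMapping.eventually_momentSum_zero_pos r]
      with n hn hpos
    have := RandomMapping.isProbabilityMeasure_mappingLaw hn hpos
    simp only [Pi.div_apply]
    rw [variance_eq_sub MemLp.of_discrete, div_pow, Real.sq_sqrt (Nat.cast_nonneg _), ← sub_div,
      div_div, mul_comm (n : ℝ)]
    simp only [Pi.pow_apply]
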